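/- Let $G$ be a finitely generated group. For a subgroup $H\le G$, a subset $W\subseteq G$ is $H$-finite if it is contained in finitely many cosets $Hg$. A subset $X\subseteq G$ is $H$-almost invariant if $hX=X$ for all $h\in H$ and, for every $g\in G$, the images of $Xg$ and $X$ in $H\backslash G$ differ by finitely many elements; it is nontrivial if the images of $X$ and of its complement $X^*$ in $H\backslash G$ are both infinite. An $H$-almost invariant set $X$ and a $K$-almost invariant set $Y$ are equivalent if their symmetric difference is $H$-finite. $X$ is invertible if $gX=X^*$ for some $g\in G$. The $G$-orbits of $X$ and $X'$ are parallel if some translate $gX$ is equivalent to $X'$ or to $X'^*$. For a family $X_1,\dots,X_n$ of nontrivial almost invariant sets let $E(X_1,\dots,X_n)=\{gX_i,\,gX_i^*: g\in G,\ 1\le i\le n\}$. The corners of $U,V\in E$ are $U\cap V$, $U^*\cap V$, $U\cap V^*$, $U^*\cap V^*$; a corner is small if it is $H$-finite, where $U$ is almost invariant over $H$. The family is in good position if, whenever two of the corners of some $U,V\in E$ are small, one of their corners is empty. Then $U\le V$ means that $U\cap V^*$ is empty or is the only small corner of $U$ and $V$. An ultrafilter on $(E,\le)$ is a subset $V\subseteq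 E$ that contains exactly one of $A,A^*$ for each $A\in E$ and is closed upwards under $\le$. Let $\Lambda$ be the cubed complex whose vertices are these ultrafilters, with an edge joining two ultrafilters that differ by replacing a single element by its complement, and with one $d$-cube ($d\ge2$) attached for each occurrence of the boundary of a $d$-cube in the $(d-1)$-skeleton. Let $L(X_1,\dots,X_n)$ be the $G$-invariant component of $\Lambda$ containing the ultrafilters that agree, except on a finite subset of $E$, with $\{A\in E: g\in A\}$ for some $g\in G$. **Lemma.** Let $H_1,\dots,H_n$ be finitely generated subgroups of $G$, and for each $i$ let $X_i$ be a nontrivial $H_i$-almost invariant subset of $G$. Suppose that for distinct $i,j$ the $G$-orbits of $X_i$ and $X_j$ are not parallel. Suppose that each $X_i$ is equivalent to almost invariant sets $Y_i$ and $Z_i$, that the family $(Y_i)$ is in good position, that the family $(Z_i)$ is in good position, and that no $Y_i$ and no $Z_i$ is invertible. Then there is a $G$-equivariant bijection $\varphi:E(Y_1,\dots,Y_n)\to E(Z_1,\dots,Z_n)$ that preserves complementation, is an isomorphism for the partial orders $\le$ (that is, $U\le V$ if and only if $\varphi(U)\le\varphi(V)$), and preserves equivalence classes (that is, $\varphi(U)$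 is equivalent to $U$ for every $U$). Moreover $V\mapsto\varphi(V)$ defines a $G$-equivariant isomorphism of cubed complexes $L(Y_1,\dots,Y_n)\to L(Z_1,\dots,Z_n)$. Hence the cubing $L$ depends only on the equivalence classes of the $X_i$. -/

import Mathlib

open scoped Pointwise

namespace AlmostInvariant

variable {G : Type*} [Group G]

/-- The projection `G → H\G` onto the set of cosets `Hg`, i.e. the quotient of `G` by the left
action of `H`. -/
def proj (H : Subgroup G) (x : G) : Quotient (QuotientGroup.rightRel H) :=
  Quotient.mk (QuotientGroup.rightRel H) x

/-- Two sets are almost equal if their symmetric difference is finite. -/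
def AlmostEqual {α : Type*} (P Q : Set α) : Prop :=
  (symmDiff P Q).Finite

/-- `X` is almost invariant over `H`: it is invariant under the left action of `H`, and `H\X` is an
almost invariant subset of `H\G` for the right action of `G`. The translate `(H\X)g` is the
projection of `Xg`. -/
def IsAlmostInvariant (H : Subgroup G) (X : Set G) : Prop :=
  (∀ h ∈ H, h • X = X) ∧
    ∀ g : G, AlmostEqual (proj H '' (MulOpposite.op g • X)) (proj H '' X)

/-- `X` is a nontrivial `H`-almost invariant set: moreover `H\X` and `H\X*` are both infinite. -/
def IsNontrivialAlmostInvariant (H : Subgroup G) (X : Set G) : Prop :=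
  IsAlmostInvariant H X ∧ (proj H '' X).Infinite ∧ (proj H '' Xᶜ).Infinite

/-- `W` is contained in the union of finitely many cosets `Hg`. -/
def IsFiniteOver (H : Subgroup G) (W : Set G) : Prop :=
  ∃ F : Set G, F.Finite ∧ W ⊆ (H : Set G) * F

/-- The symmetric difference of `V` and `W` is `H`-finite. -/
def AlmostEqualOver (H : Subgroup G) (V W : Set G) : Prop :=
  IsFiniteOver H (symmDiff V W)

/-- Equivalence of almost invariant sets: `X` is `H`-almost invariant, `Y` is `K`-almost
invariant, and they are `H`-almost equal. -/
def Equivalent (X Y : Set G) : Prop :=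
  ∃ H K : Subgroup G, IsAlmostInvariant H X ∧ IsAlmostInvariant K Y ∧ AlmostEqualOver H X Y

/-- The intersection of `U` and `V` is small: it is `H`-finite, where `U` is nontrivial and almost
invariant over `H`. -/
def IsSmallInter (U V : Set G) : Prop :=
  ∃ H : Subgroup G, IsNontrivialAlmostInvariant H U ∧ IsFiniteOver H (U ∩ V)

/-- `X` is invertible if some translate of it is its complement. -/
def IsInvertible (X : Set G) : Prop :=
  ∃ g : G, g • X = Xᶜ

/-- The `G`-orbits of `X` and `Y` are parallel if some translate of `X` is equivalent to `Y` or to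
the complement of `Y`. -/
def OrbitsParallel (X Y : Set G) : Prop :=
  ∃ g : G, Equivalent (g • X) Y ∨ Equivalent (g • X) Yᶜ

/-- `U` or its complement, according to a sign. -/
def signed (U : Set G) : Bool → Set G
  | true => U
  | false => Uᶜ

/-- Almost inclusion: `U ∩ V*` is empty, or it is the only small one among the four corners of `U`
and `V`. -/
def AlmostLE (U V : Set G) : Prop :=
  U ∩ Vᶜ = ∅ ∨
    (IsSmallInter U Vᶜ ∧ ¬ IsSmallInter U V ∧ ¬ IsSmallInter Uᶜ V ∧ ¬ IsSmallInter Uᶜ Vᶜ)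

section Family

variable {ι : Type*}

/-- The set `E(X)` of all translates of the sets `X i` and of their complements. -/
def translates (X : ι → Set G) : Set (Set G) :=
  {A | ∃ (g : G) (i : ι), A = g • X i ∨ A = g • (X i)ᶜ}

/-- Good position: if two of the four corners of two elements of `E(X)` are small, then one of
their corners is empty. -/
def GoodPosition (X : ι → Set G) : Prop :=
  ∀ U ∈ translates X, ∀ V ∈ translates X, ∀ a b a' b' : Bool, (a, b) ≠ (a', b') →
    IsSmallInter (signed U a) (signed V b) → IsSmallInter (signed U a') (signed V b') →
      ∃ c d : Bool, signed U c ∩ signed V d = ∅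

theorem smul_mem_translates (X : ι → Set G) (g : G) {A : Set G} (hA : A ∈ translates X) :
    g • A ∈ translates X := by
  obtain ⟨k, i, rfl | rfl⟩ := hA
  · exact ⟨g * k, i, Or.inl (smul_smul _ _ _)⟩
  · exact ⟨g * k, i, Or.inr (smul_smul _ _ _)⟩

theorem compl_mem_translates (X : ι → Set G) {A : Set G} (hA : A ∈ translates X) :
    Aᶜ ∈ translates X := by
  obtain ⟨k, i, rfl | rfl⟩ := hA
  · exact ⟨k, i, Or.inr (Set.smul_set_compl).symm⟩
  · exact ⟨k, i, Or.inl (by rw [Set.smul_set_compl, compl_compl])⟩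

/-- The left action of `G` on `E(X)`. -/
instance translatesAction (X : ι → Set G) : MulAction G (translates X) where
  smul g A := ⟨g • A.1, smul_mem_translates X g A.2⟩
  one_smul A := Subtype.ext (one_smul G A.1)
  mul_smul g h A := Subtype.ext (mul_smul g h A.1)

/-- The involution `A ↦ A*` of `E(X)`. -/
def star {X : ι → Set G} (A : translates X) : translates X :=
  ⟨A.1ᶜ, compl_mem_translates X A.2⟩

/-- The ultrafilters on `E(X)` with respect to almost inclusion. -/
@[ext]
structure UltrafilterOn (X : ι → Set G) where
  /-- the underlying subset of `E(X)` -/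
  carrier : Set (translates X)
  mem_or : ∀ A, A ∈ carrier ∨ star A ∈ carrier
  not_both : ∀ A, ¬ (A ∈ carrier ∧ star A ∈ carrier)
  upward : ∀ A ∈ carrier, ∀ B : translates X, AlmostLE A.1 B.1 → B ∈ carrier

end Family

/-! Invariance of almost inclusion under translation, needed for the action on ultrafilters. -/

theorem proj_eq_iff (H : Subgroup G) (x y : G) : proj H x = proj H y ↔ y * x⁻¹ ∈ H := by
  unfold proj
  rw [Quotient.eq]
  exact QuotientGroup.rightRel_apply

/-- The conjugate subgroup `gHg⁻¹`. -/
def conj (g : G) (H : Subgroup G) : Subgroup G := H.map (MulAut.conj g).toMonoidHom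

theorem mem_conj (g : G) (H : Subgroup G) (x : G) : x ∈ conj g H ↔ g⁻¹ * x * g ∈ H := by
  unfold conj
  rw [Subgroup.mem_map]
  constructor
  · rintro ⟨y, hy, rfl⟩
    simpa [mul_assoc] using hy
  · intro h
    exact ⟨_, h, by simp [mul_assoc]⟩

theorem exists_transport (g : G) (H : Subgroup G) :
    ∃ e : Quotient (QuotientGroup.rightRel H) → Quotient (QuotientGroup.rightRel (conj g H)),
      Function.Injective e ∧ ∀ S : Set G, proj (conj g H) '' (g • S) = e '' (proj H '' S) := by
  have key : ∀ x y : G, proj H x = proj H y ↔ proj (conj g H) (g * x) = proj (conj g H) (g * y) := by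
    intro x y
    rw [proj_eq_iff, proj_eq_iff, mem_conj]
    simp [mul_assoc]
  refine ⟨Quotient.lift (fun x => proj (conj g H) (g * x)) ?_, ?_, ?_⟩
  · intro x y h
    exact (key x y).1 (Quotient.sound h)
  · intro p q
    induction p using Quotient.inductionOn with
    | h x =>
      induction q using Quotient.inductionOn with
      | h y => exact fun h => (key x y).2 h
  · intro S
    ext q
    constructor
    · rintro ⟨_, ⟨x, hx, rfl⟩, rfl⟩
      exact ⟨proj H x, ⟨x, hx, rfl⟩, rfl⟩
    · rintro ⟨_, ⟨x, hx, rfl⟩, rfl⟩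
      exact ⟨g • x, ⟨x, hx, rfl⟩, rfl⟩

theorem IsAlmostInvariant.smul {H : Subgroup G} {X : Set G} (h : IsAlmostInvariant H X) (g : G) :
    IsAlmostInvariant (conj g H) (g • X) := by
  obtain ⟨e, he, hS⟩ := exists_transport g H
  refine ⟨fun k hk => ?_, fun a => ?_⟩
  · have := h.1 _ ((mem_conj g H k).1 hk)
    calc k • g • X = g • ((g⁻¹ * k * g) • X) := by simp [smul_smul, mul_assoc]
      _ = g • X := by rw [this]
  · have h2 := h.2 a
    unfold AlmostEqual at h2 ⊢
    rw [smul_comm, hS, hS, ← Set.image_symmDiff he]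
    exact h2.image e

theorem IsNontrivialAlmostInvariant.smul {H : Subgroup G} {X : Set G}
    (h : IsNontrivialAlmostInvariant H X) (g : G) :
    IsNontrivialAlmostInvariant (conj g H) (g • X) := by
  obtain ⟨e, he, hS⟩ := exists_transport g H
  refine ⟨h.1.smul g, ?_, ?_⟩
  · rw [hS]
    exact h.2.1.image he.injOn
  · rw [← Set.smul_set_compl, hS]
    exact h.2.2.image he.injOn

theorem IsSmallInter.smul {U V : Set G} (h : IsSmallInter U V) (g : G) :
    IsSmallInter (g • U) (g • V) := by
  obtain ⟨H, hU, F, hF, hs⟩ := h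
  refine ⟨conj g H, hU.smul g, g • F, hF.smul_set, ?_⟩
  rw [← Set.smul_set_inter]
  rintro _ ⟨x, hx, rfl⟩
  obtain ⟨k, hk, f, hf, rfl⟩ := Set.mem_mul.1 (hs hx)
  refine Set.mem_mul.2 ⟨g * k * g⁻¹, (mem_conj g H _).2 ?_, g * f, ⟨f, hf, rfl⟩, ?_⟩
  · simpa [mul_assoc] using hk
  · simp [mul_assoc]

theorem isSmallInter_smul_iff (g : G) (U V : Set G) :
    IsSmallInter (g • U) (g • V) ↔ IsSmallInter U V :=
  ⟨fun h => by simpa using h.smul g⁻¹, fun h => h.smul g⟩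

theorem almostLE_smul_iff (g : G) (U V : Set G) : AlmostLE (g • U) (g • V) ↔ AlmostLE U V := by
  unfold AlmostLE
  simp only [← Set.smul_set_compl, ← Set.smul_set_inter, isSmallInter_smul_iff,
    Set.smul_set_eq_empty]

section Cubing

variable {ι : Type*} {X : ι → Set G}

theorem star_smul (g : G) (A : translates X) : star (g • A) = g • star A :=
  Subtype.ext (Set.smul_set_compl).symm

theorem star_star (A : translates X) : star (star A) = A :=
  Subtype.ext (compl_compl A.1)

/-- The action of `G` on the ultrafilters induced by its action on `E(X)`. -/
instance ultrafilterAction (X : ι → Set G) : MulAction G (UltrafilterOn X) where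
  smul g V :=
    { carrier := g • V.carrier
      mem_or := fun A => by
        simp only [Set.mem_smul_set_iff_inv_smul_mem, ← star_smul]
        exact V.mem_or _
      not_both := fun A => by
        simp only [Set.mem_smul_set_iff_inv_smul_mem, ← star_smul]
        exact V.not_both _
      upward := fun A hA B hAB => by
        rw [Set.mem_smul_set_iff_inv_smul_mem] at hA ⊢
        exact V.upward _ hA _ ((almostLE_smul_iff g⁻¹ A.1 B.1).2 hAB) }
  one_smul V := UltrafilterOn.ext (one_smul G V.carrier)
  mul_smul g h V := UltrafilterOn.ext (mul_smul g h V.carrier)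

theorem carrier_smul (g : G) (V : UltrafilterOn X) : (g • V).carrier = g • V.carrier := rfl

/-- The 1-skeleton of the cubed complex `Λ`: its vertices are the ultrafilters, and two of them
are joined by an edge if they differ by replacing a single element by its complement. -/
def skeleton (X : ι → Set G) : SimpleGraph (UltrafilterOn X) where
  Adj V W := ∃ A ∈ V.carrier, W.carrier = (V.carrier \ {A}) ∪ {star A}
  symm := ⟨by
    rintro V W ⟨A, hA, hW⟩
    have hsA : star A ∉ V.carrier := fun h => V.not_both A ⟨hA, h⟩
    refine ⟨star A, by simp [hW], ?_⟩
    rw [hW, star_star]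
    ext B
    simp only [Set.mem_union, Set.mem_sdiff, Set.mem_singleton_iff]
    constructor
    · intro hB
      by_cases h : B = A
      · exact Or.inr h
      · exact Or.inl ⟨Or.inl ⟨hB, h⟩, fun h' => hsA (h' ▸ hB)⟩
    · rintro (⟨h | h, h'⟩ | h)
      · exact h.1
      · exact absurd h h'
      · exact h ▸ hA⟩
  loopless := ⟨by
    rintro V ⟨A, hA, hV⟩
    have hs : star A ∈ V.carrier := by
      rw [hV]
      simp
    exact V.not_both A ⟨hA, hs⟩⟩

/-- An ultrafilter agreeing, except on a finite subset of `E(X)`, with the set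
`{A ∈ E(X) | g ∈ A}` for some `g` in `G`. -/
def IsBasic (W : UltrafilterOn X) : Prop :=
  ∃ g : G, AlmostEqual W.carrier {A | g ∈ A.1}

/-- The vertices of `L(X)`, the component of the cubed complex `Λ` that contains the basic
vertices. -/
def LVertex (X : ι → Set G) : Type _ :=
  {V : UltrafilterOn X // ∃ W, IsBasic W ∧ (skeleton X).Reachable W V}

theorem skeleton_adj_smul (g : G) {V W : UltrafilterOn X} (h : (skeleton X).Adj V W) :
    (skeleton X).Adj (g • V) (g • W) := by
  obtain ⟨A, hA, hW⟩ := h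
  refine ⟨g • A, Set.smul_mem_smul_set hA, ?_⟩
  rw [carrier_smul, carrier_smul, hW, Set.smul_set_union, Set.smul_set_sdiff,
    Set.smul_set_singleton, Set.smul_set_singleton, star_smul]

theorem IsBasic.smul {W : UltrafilterOn X} (h : IsBasic W) (g : G) : IsBasic (g • W) := by
  obtain ⟨k, hk⟩ := h
  refine ⟨g * k, ?_⟩
  have : {A : translates X | g * k ∈ A.1} = g • {A : translates X | k ∈ A.1} := by
    ext A
    rw [Set.mem_smul_set_iff_inv_smul_mem]
    change g * k ∈ A.1 ↔ k ∈ g⁻¹ • A.1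
    rw [Set.mem_smul_set_iff_inv_smul_mem, inv_inv, smul_eq_mul]
  unfold AlmostEqual at hk ⊢
  rw [this, carrier_smul, ← Set.smul_set_symmDiff]
  exact hk.smul_set

/-- The action of `G` on the vertices of `L(X)`. -/
instance lVertexAction (X : ι → Set G) : MulAction G (LVertex X) where
  smul g V := ⟨g • V.1, by
    obtain ⟨W, hW, hr⟩ := V.2
    let f : skeleton X →g skeleton X := ⟨fun U => g • U, fun h => skeleton_adj_smul g h⟩
    exact ⟨g • W, hW.smul g, hr.map f⟩⟩
  one_smul V := Subtype.ext (one_smul G V.1)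
  mul_smul g h V := Subtype.ext (mul_smul g h V.1)

/-- The cubes of `L(X)`. In dimensions at least two, exactly one cube is glued in for each
occurrence of the boundary of a cube in the skeleton one dimension lower. So a `d`-cube is given by
its set of vertices, and the sets that occur are the images of the injective maps from the vertices
of the standard `d`-cube that send edges to edges. -/
def IsCube (X : ι → Set G) (d : ℕ) (S : Set (LVertex X)) : Prop :=
  ∃ f : (Fin d → Bool) → LVertex X, Function.Injective f ∧ Set.range f = S ∧
    ∀ a b, hammingDist a b = 1 → (skeleton X).Adj (f a).1 (f b).1

end Cubing

end AlmostInvariant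

open scoped Pointwise

namespace AlmostInvariant

variable {G : Type*} [Group G]

/-! ### Finiteness over a subgroup -/

/-! Smallness of a corner depends only on the equivalence classes of the two sets
(`isSmallInter_congr`). So for inequivalent `U`, `V` the relation `U ≤ V` does too, since an empty
corner `U ∩ V*` is then their only small one. The order can depend on the chosen representatives
only inside an equivalence class of translates. There good position makes `≤` a total order by
inclusion (`GoodPosition.subset_or_subset`), and nonparallelism leaves a single index `i`.

Inclusions `gYᵢ ⊆ kYᵢ` inside a class say that `k⁻¹g` contracts `Yᵢ`. If it expanded `Zᵢ`, its
powers of one sign would keep some point in the difference of `Yᵢ` and `Zᵢ`, which is finite over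
the stabilizer of `Zᵢ`. A positive power would then fix `Zᵢ`, forcing equality
(`Equivalent.smul_subset`).

Inclusions `gYᵢ ⊆ kYᵢ*` are the real difficulty: the map `gYᵢ ↦ gZᵢ` need not respect them. If `rYᵢ`
is equivalent to `Yᵢ*`, then `B ↦ rB*` is an order-reversing involution of the class of `Yᵢ`, and it
has an innermost pair `A ⊆ rA*` (`GoodPosition.exists_isCentral`). Noninvertibility rules out `A =
rA*`, and seen from this centre `gA ⊆ A*` means `rg⁻¹A ⊆ A`, an inclusion of the first kind
(`GoodPosition.smul_subset_compl_iff`). Rebasing both families at central translates with a common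
`r` leaves the sets of translates unchanged, and the map by equal group elements becomes an order
isomorphism.

Finally, a given point distinguishes only finitely many `A` from their images, so basic ultrafilters
go to basic ones and the component `L` is preserved. -/

theorem isFiniteOver_iff (H : Subgroup G) (W : Set G) :
    IsFiniteOver H W ↔ (proj H '' W).Finite := by
  constructor
  · rintro ⟨F, hF, hW⟩
    refine (hF.image (proj H)).subset ?_
    rintro _ ⟨w, hw, rfl⟩
    obtain ⟨h, hh, f, hf, rfl⟩ := Set.mem_mul.1 (hW hw)
    refine ⟨f, hf, ((proj_eq_iff H _ _).2 ?_)⟩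
    simpa using hh
  · intro h
    refine ⟨Quotient.out '' (proj H '' W), h.image _, fun w hw => ?_⟩
    refine Set.mem_mul.2 ⟨w * (proj H w).out⁻¹, ?_, (proj H w).out, ⟨_, ⟨w, hw, rfl⟩, rfl⟩, by simp⟩
    exact (proj_eq_iff H _ _).1 (Quotient.out_eq (proj H w))

theorem IsFiniteOver.mono {H : Subgroup G} {V W : Set G} (h : IsFiniteOver H W) (hVW : V ⊆ W) :
    IsFiniteOver H V :=
  let ⟨F, hF, hW⟩ := h
  ⟨F, hF, hVW.trans hW⟩

theorem IsFiniteOver.union {H : Subgroup G} {V W : Set G} (hV : IsFiniteOver H V)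
    (hW : IsFiniteOver H W) : IsFiniteOver H (V ∪ W) := by
  rw [isFiniteOver_iff] at *
  rw [Set.image_union]
  exact hV.union hW

theorem isFiniteOver_empty (H : Subgroup G) : IsFiniteOver H ∅ :=
  ⟨∅, Set.finite_empty, by simp⟩

theorem IsFiniteOver.biUnion {H : Subgroup G} {α : Type*} {s : Set α} (hs : s.Finite)
    {W : α → Set G} (h : ∀ a ∈ s, IsFiniteOver H (W a)) : IsFiniteOver H (⋃ a ∈ s, W a) := by
  rw [isFiniteOver_iff, Set.image_iUnion₂]
  exact hs.biUnion fun a ha => (isFiniteOver_iff H _).1 (h a ha)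

theorem IsFiniteOver.trans {H K : Subgroup G} {W : Set G} (hW : IsFiniteOver H W)
    (hHK : IsFiniteOver K (H : Set G)) : IsFiniteOver K W := by
  obtain ⟨F, hF, hW⟩ := hW
  obtain ⟨F', hF', hH⟩ := hHK
  refine ⟨F' * F, hF'.mul hF, hW.trans ?_⟩
  rw [← mul_assoc]
  exact Set.mul_subset_mul_right hH

/-- A subgroup is finite over `K` as soon as one of its cosets is. -/
theorem isFiniteOver_of_coset {H K : Subgroup G} {W : Set G} (hW : IsFiniteOver K W) (x : G)
    (hx : ∀ h ∈ H, h * x ∈ W) : IsFiniteOver K (H : Set G) := by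
  obtain ⟨F, hF, hW⟩ := hW
  refine ⟨(· * x⁻¹) '' F, hF.image _, fun h hh => ?_⟩
  obtain ⟨k, hk, f, hf, e⟩ := Set.mem_mul.1 (hW (hx h hh))
  exact Set.mem_mul.2 ⟨k, hk, f * x⁻¹, ⟨f, hf, rfl⟩, by rw [← mul_assoc, e]; simp⟩

/-- If all the points `g ^ n * x` lie in finitely many cosets of `K`, then a positive power of `g`
lies in `K`. -/
theorem exists_pow_mem_of_isFiniteOver {K : Subgroup G} {W : Set G} (hW : IsFiniteOver K W)
    {g x : G} (hx : ∀ n : ℕ, g ^ n * x ∈ W) : ∃ p : ℕ, 0 < p ∧ g ^ p ∈ K := by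
  rw [isFiniteOver_iff] at hW
  obtain ⟨m, -, n, -, hmn, h⟩ := Set.infinite_univ.exists_ne_map_eq_of_mapsTo
    (f := fun n : ℕ => proj K (g ^ n * x)) (t := proj K '' W) (fun n _ => ⟨_, hx n, rfl⟩) hW
  wlog hlt : m < n generalizing m n
  · exact this n m hmn.symm h.symm (by omega)
  refine ⟨n - m, by omega, ?_⟩
  have := (proj_eq_iff K _ _).1 h
  rw [pow_sub _ hlt.le]
  simpa [mul_assoc] using this

/-! ### Almost invariant sets -/

theorem mem_iff_of_smul_eq {h : G} {X : Set G} (hX : h • X = X) (x : G) : h * x ∈ X ↔ x ∈ X := by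
  conv_lhs => rw [← hX]
  exact Set.smul_mem_smul_set_iff

theorem mem_op_smul_iff (g : G) (X : Set G) (x : G) :
    x ∈ MulOpposite.op g • X ↔ x * g⁻¹ ∈ X := by
  rw [Set.mem_smul_set_iff_inv_smul_mem]
  rfl

theorem proj_mem_image_iff {H : Subgroup G} {X : Set G} (hX : ∀ h ∈ H, ∀ x, h * x ∈ X ↔ x ∈ X)
    (x : G) : proj H x ∈ proj H '' X ↔ x ∈ X := by
  refine ⟨?_, fun h => ⟨x, h, rfl⟩⟩
  rintro ⟨y, hy, e⟩
  have := hX _ ((proj_eq_iff H _ _).1 e) y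
  simpa [hy] using this

/-- Restates almost invariance inside `G`: the difference of the translate by `t⁻¹` and `X` is the
set of points where right multiplication by `t` crosses the boundary of `X`. The finiteness
arguments below catch points in such boundaries. -/
theorem isAlmostInvariant_iff (H : Subgroup G) (X : Set G) :
    IsAlmostInvariant H X ↔ (∀ h ∈ H, h • X = X) ∧
      ∀ t : G, IsFiniteOver H {x | ¬ (x ∈ X ↔ x * t ∈ X)} := by
  refine and_congr_right fun hX => ?_
  have hX' : ∀ h ∈ H, ∀ x, h * x ∈ X ↔ x ∈ X := fun h hh x => mem_iff_of_smul_eq (hX h hh) x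
  have key : ∀ g : G, symmDiff (proj H '' (MulOpposite.op g • X)) (proj H '' X) =
      proj H '' {x | ¬ (x ∈ X ↔ x * g⁻¹ ∈ X)} := by
    intro g
    have hg : ∀ h ∈ H, ∀ x, h * x ∈ MulOpposite.op g • X ↔ x ∈ MulOpposite.op g • X := by
      intro h hh x
      rw [mem_op_smul_iff, mem_op_smul_iff, mul_assoc, hX' h hh]
    have hd : ∀ h ∈ H, ∀ x, h * x ∈ {x | ¬ (x ∈ X ↔ x * g⁻¹ ∈ X)} ↔
        x ∈ {x | ¬ (x ∈ X ↔ x * g⁻¹ ∈ X)} := by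
      intro h hh x
      simp only [Set.mem_ofPred_eq, mul_assoc, hX' h hh]
    ext q
    obtain ⟨x, rfl⟩ : ∃ x, proj H x = q := ⟨q.out, Quotient.out_eq q⟩
    rw [proj_mem_image_iff hd, Set.mem_symmDiff, proj_mem_image_iff hg, proj_mem_image_iff hX',
      mem_op_smul_iff, Set.mem_ofPred_eq]
    tauto
  constructor
  · intro h t
    have := h t⁻¹
    unfold AlmostEqual at this
    rwa [key, inv_inv, ← isFiniteOver_iff] at this
  · intro h g
    unfold AlmostEqual
    rw [key, ← isFiniteOver_iff]
    exact h g⁻¹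

theorem isNontrivialAlmostInvariant_iff (H : Subgroup G) (X : Set G) :
    IsNontrivialAlmostInvariant H X ↔
      IsAlmostInvariant H X ∧ ¬ IsFiniteOver H X ∧ ¬ IsFiniteOver H Xᶜ := by
  rw [isFiniteOver_iff, isFiniteOver_iff]
  rfl

theorem IsAlmostInvariant.mul_mem_iff {H : Subgroup G} {X : Set G} (h : IsAlmostInvariant H X)
    {k : G} (hk : k ∈ H) (x : G) : k * x ∈ X ↔ x ∈ X :=
  mem_iff_of_smul_eq (h.1 k hk) x

theorem IsAlmostInvariant.isFiniteOver_boundary {H : Subgroup G} {X : Set G}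
    (h : IsAlmostInvariant H X) (t : G) : IsFiniteOver H {x | ¬ (x ∈ X ↔ x * t ∈ X)} :=
  ((isAlmostInvariant_iff H X).1 h).2 t

theorem IsAlmostInvariant.compl {H : Subgroup G} {X : Set G} (h : IsAlmostInvariant H X) :
    IsAlmostInvariant H Xᶜ := by
  rw [isAlmostInvariant_iff] at *
  refine ⟨fun k hk => by rw [Set.smul_set_compl, h.1 k hk], fun t => (h.2 t).mono ?_⟩
  intro x
  simp only [Set.mem_ofPred_eq, Set.mem_compl_iff]
  tauto

theorem IsNontrivialAlmostInvariant.compl {H : Subgroup G} {X : Set G}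
    (h : IsNontrivialAlmostInvariant H X) : IsNontrivialAlmostInvariant H Xᶜ := by
  refine ⟨h.1.compl, h.2.2, ?_⟩
  rw [compl_compl]
  exact h.2.1

/-! ### Independence of the subgroup -/

section Commensurability

variable {H K : Subgroup G} {U V : Set G}

theorem IsNontrivialAlmostInvariant.not_isFiniteOver (h : IsNontrivialAlmostInvariant H U) :
    ¬ IsFiniteOver H U :=
  ((isNontrivialAlmostInvariant_iff H U).1 h).2.1

theorem IsNontrivialAlmostInvariant.exists_notMem {W : Set G}
    (h : IsNontrivialAlmostInvariant H U) (hW : IsFiniteOver H W) : ∃ x ∈ U, x ∉ W := by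
  by_contra! hc
  exact h.not_isFiniteOver (hW.mono hc)

/-- The subgroup of a nontrivial almost invariant set is finite over that of any almost invariant
set almost equal to it. -/
theorem isFiniteOver_subgroup_of_almostEqualOver (hU : IsNontrivialAlmostInvariant H U)
    (hV : IsAlmostInvariant K V) (h : AlmostEqualOver H U V) : IsFiniteOver K (H : Set G) := by
  obtain ⟨F, hF, hW⟩ := h
  have hW' : IsFiniteOver H ((H : Set G) * F) := ⟨F, hF, subset_rfl⟩
  have hinv : ∀ k ∈ H, ∀ x, x ∉ (H : Set G) * F → (k * x ∈ V ↔ x ∈ U) := by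
    intro k hk x hx
    have hkx : k * x ∉ (H : Set G) * F := by
      intro hc
      obtain ⟨k', hk', f, hf, e⟩ := Set.mem_mul.1 hc
      exact hx (Set.mem_mul.2 ⟨k⁻¹ * k', H.mul_mem (H.inv_mem hk) hk', f, hf, by
        rw [mul_assoc, e]; simp⟩)
    have h1 : k * x ∉ symmDiff U V := fun hc => hkx (hW hc)
    rw [Set.mem_symmDiff, hU.1.mul_mem_iff hk] at h1
    tauto
  obtain ⟨x, hx, hxW⟩ := hU.exists_notMem hW'
  obtain ⟨y, hy, hyW⟩ := hU.compl.exists_notMem hW'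
  -- Outside `HF` the sets `U` and `V` agree, so `V` separates `kx` from `ky` for every `k ∈ H`;
  -- thus `Hx` lies in one boundary of `V`.
  refine isFiniteOver_of_coset (hV.isFiniteOver_boundary (x⁻¹ * y)) x fun k hk => ?_
  have h1 := hinv k hk x hxW
  have h2 := hinv k hk y hyW
  have h3 : k * x * (x⁻¹ * y) = k * y := by group
  simp only [Set.mem_compl_iff] at hy
  simp only [Set.mem_ofPred_eq, h3]
  tauto

theorem nonempty_of_not_isFiniteOver {W : Set G} (h : ¬ IsFiniteOver H W) : W.Nonempty := by
  by_contra hc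
  rw [Set.not_nonempty_iff_eq_empty] at hc
  exact h (hc ▸ isFiniteOver_empty H)

theorem IsFiniteOver.mul_singleton {W : Set G} (h : IsFiniteOver H W) (t : G) :
    IsFiniteOver H {x | x * t ∈ W} := by
  obtain ⟨F, hF, hW⟩ := h
  refine ⟨(· * t⁻¹) '' F, hF.image _, fun x hx => ?_⟩
  obtain ⟨k, hk, f, hf, e⟩ := Set.mem_mul.1 (hW hx)
  exact Set.mem_mul.2 ⟨k, hk, f * t⁻¹, ⟨f, hf, rfl⟩, by rw [← mul_assoc, e]; simp⟩

/-- The subgroup of an almost invariant set almost equal to a nontrivial one is finite over the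
subgroup of the latter. -/
theorem isFiniteOver_subgroup_of_almostEqualOver' (hU : IsNontrivialAlmostInvariant H U)
    (hV : IsAlmostInvariant K V) (h : AlmostEqualOver H U V) : IsFiniteOver H (K : Set G) := by
  obtain ⟨x, hx, hxW⟩ := hU.exists_notMem h
  obtain ⟨y, hy, hyW⟩ := hU.compl.exists_notMem h
  have hxV : x ∈ V := by
    rw [Set.mem_symmDiff] at hxW
    tauto
  have hyV : y ∉ V := by
    rw [Set.mem_symmDiff] at hyW
    simp only [Set.mem_compl_iff] at hy
    tauto
  have hb := ((hU.1.isFiniteOver_boundary (x⁻¹ * y)).union h).union (h.mul_singleton (x⁻¹ * y))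
  -- For `k ∈ K`, `V` separates `kx` from `ky`. Either `U` does so too, or `U` and `V` differ at one
  -- of the two points.
  refine isFiniteOver_of_coset hb x fun k hk => ?_
  have h1 := hV.mul_mem_iff hk x
  have h2 := hV.mul_mem_iff hk y
  have h3 : k * x * (x⁻¹ * y) = k * y := by group
  simp only [Set.mem_union, Set.mem_ofPred_eq, h3, Set.mem_symmDiff]
  tauto

theorem isFiniteOver_congr (hU : IsNontrivialAlmostInvariant H U)
    (hV : IsAlmostInvariant K V) (h : AlmostEqualOver H U V) (W : Set G) :
    IsFiniteOver H W ↔ IsFiniteOver K W :=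
  ⟨fun hW => hW.trans (isFiniteOver_subgroup_of_almostEqualOver hU hV h),
    fun hW => hW.trans (isFiniteOver_subgroup_of_almostEqualOver' hU hV h)⟩

theorem IsNontrivialAlmostInvariant.of_almostEqualOver (hU : IsNontrivialAlmostInvariant H U)
    (hV : IsAlmostInvariant K V) (h : AlmostEqualOver H U V) :
    IsNontrivialAlmostInvariant K V := by
  rw [isNontrivialAlmostInvariant_iff]
  refine ⟨hV, fun hc => hU.not_isFiniteOver ?_, fun hc => hU.compl.not_isFiniteOver ?_⟩
  all_goals
    rw [← isFiniteOver_congr hU hV h] at hc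
    refine (hc.union h).mono fun x hx => ?_
    simp only [Set.mem_union, Set.mem_symmDiff, Set.mem_compl_iff] at *
    tauto

theorem almostEqualOver_self : AlmostEqualOver H U U := by
  unfold AlmostEqualOver
  rw [symmDiff_self]
  exact isFiniteOver_empty H

theorem isFiniteOver_congr_subgroup (hU : IsNontrivialAlmostInvariant H U)
    (hK : IsAlmostInvariant K U) (W : Set G) : IsFiniteOver H W ↔ IsFiniteOver K W :=
  isFiniteOver_congr hU hK almostEqualOver_self W

theorem isSmallInter_iff (hU : IsNontrivialAlmostInvariant H U) :
    IsSmallInter U V ↔ IsFiniteOver H (U ∩ V) :=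
  ⟨fun ⟨_, hK, h⟩ => (isFiniteOver_congr_subgroup hK hU.1 _).1 h, fun h => ⟨H, hU, h⟩⟩

/-- Smallness of an intersection does not depend on the order of the two sets. -/
theorem isFiniteOver_inter_of_isFiniteOver_inter (hU : IsNontrivialAlmostInvariant H U)
    (hV : IsAlmostInvariant K V) (h : IsFiniteOver H (U ∩ V)) : IsFiniteOver K (U ∩ V) := by
  obtain ⟨F, hF, hW⟩ := h
  obtain ⟨x, hx, hxW⟩ := hU.exists_notMem ⟨F, hF, subset_rfl⟩
  -- The orbit `Hx` lies in `U` and misses `HF`, hence misses `V`. So a point `kf` of `U ∩ V` is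
  -- carried out of `V` by right multiplication by `f⁻¹x`.
  refine (IsFiniteOver.biUnion hF fun f _ => hV.isFiniteOver_boundary (f⁻¹ * x)).mono ?_
  intro w hw
  obtain ⟨k, hk, f, hf, rfl⟩ := Set.mem_mul.1 (hW hw)
  simp only [Set.mem_iUnion]
  refine ⟨f, hf, ?_⟩
  have h3 : k * f * (f⁻¹ * x) = k * x := by group
  have h4 : k * x ∉ V := by
    intro hc
    obtain ⟨k', hk', f', hf', e⟩ := Set.mem_mul.1 (hW ⟨(hU.1.mul_mem_iff hk x).2 hx, hc⟩)
    exact hxW (Set.mem_mul.2 ⟨k⁻¹ * k', H.mul_mem (H.inv_mem hk) hk', f', hf', by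
      rw [mul_assoc, e]; simp⟩)
  simp only [Set.mem_ofPred_eq, h3]
  have := hw.2
  tauto

end Commensurability

/-- `U` is a nontrivial almost invariant set over some subgroup. -/
def IsNontrivial (U : Set G) : Prop :=
  ∃ H : Subgroup G, IsNontrivialAlmostInvariant H U

/-! ### Equivalence classes and small corners -/

section Equivalence

variable {U V W U' V' : Set G}

theorem IsNontrivial.compl (h : IsNontrivial U) : IsNontrivial Uᶜ :=
  h.imp fun _ hH => hH.compl

theorem IsNontrivial.smul (h : IsNontrivial U) (g : G) : IsNontrivial (g • U) :=
  let ⟨H, hH⟩ := h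
  ⟨conj g H, hH.smul g⟩

theorem IsNontrivialAlmostInvariant.isFiniteOver_symmDiff {H : Subgroup G}
    (hU : IsNontrivialAlmostInvariant H U) (h : Equivalent U V) :
    IsFiniteOver H (symmDiff U V) := by
  obtain ⟨H', K, hH', -, h⟩ := h
  exact (isFiniteOver_congr_subgroup hU hH' _).2 h

theorem IsNontrivial.of_equivalent (hU : IsNontrivial U) (h : Equivalent U V) :
    IsNontrivial V := by
  obtain ⟨H, hU⟩ := hU
  have h1 := hU.isFiniteOver_symmDiff h
  obtain ⟨_, K, -, hK, -⟩ := h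
  exact ⟨K, hU.of_almostEqualOver hK h1⟩

theorem IsNontrivial.equivalent_refl (hU : IsNontrivial U) : Equivalent U U :=
  let ⟨H, hH⟩ := hU
  ⟨H, H, hH.1, hH.1, almostEqualOver_self⟩

theorem IsNontrivial.equivalent_symm (hU : IsNontrivial U) (h : Equivalent U V) :
    Equivalent V U := by
  obtain ⟨H, hU⟩ := hU
  have h1 := hU.isFiniteOver_symmDiff h
  obtain ⟨_, K, -, hK, -⟩ := h
  refine ⟨K, H, hK, hU.1, ?_⟩
  unfold AlmostEqualOver
  rw [symmDiff_comm]
  exact (isFiniteOver_congr hU hK h1 _).1 h1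

theorem IsNontrivial.equivalent_trans (hU : IsNontrivial U) (h : Equivalent U V)
    (h' : Equivalent V W) : Equivalent U W := by
  obtain ⟨H, hU⟩ := hU
  have h1 := hU.isFiniteOver_symmDiff h
  obtain ⟨_, K, -, hK, -⟩ := h
  have h2 := (hU.of_almostEqualOver hK h1).isFiniteOver_symmDiff h'
  rw [← isFiniteOver_congr hU hK h1] at h2
  obtain ⟨_, L, -, hL, -⟩ := h'
  exact ⟨H, L, hU.1, hL, (h1.union h2).mono (symmDiff_triangle U V W)⟩

theorem Equivalent.compl (h : Equivalent U V) : Equivalent Uᶜ Vᶜ := by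
  obtain ⟨H, K, hU, hV, h⟩ := h
  refine ⟨H, K, hU.compl, hV.compl, h.mono fun x hx => ?_⟩
  simp only [Set.mem_symmDiff, Set.mem_compl_iff] at *
  tauto

theorem IsFiniteOver.smul {H : Subgroup G} (h : IsFiniteOver H W) (g : G) :
    IsFiniteOver (conj g H) (g • W) := by
  obtain ⟨e, -, hS⟩ := exists_transport g H
  rw [isFiniteOver_iff] at *
  rw [hS]
  exact h.image e

theorem Equivalent.smul (h : Equivalent U V) (g : G) : Equivalent (g • U) (g • V) := by
  obtain ⟨H, K, hU, hV, h⟩ := h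
  refine ⟨conj g H, conj g K, hU.smul g, hV.smul g, ?_⟩
  unfold AlmostEqualOver
  rw [← Set.smul_set_symmDiff]
  exact IsFiniteOver.smul h g

theorem IsNontrivial.isSmallInter_comm (hV : IsNontrivial V) (h : IsSmallInter U V) :
    IsSmallInter V U := by
  obtain ⟨H, hU, h⟩ := h
  obtain ⟨K, hV⟩ := hV
  refine ⟨K, hV, ?_⟩
  rw [Set.inter_comm]
  exact isFiniteOver_inter_of_isFiniteOver_inter hU hV.1 h

theorem IsSmallInter.congr_left (h : IsSmallInter U V) (hU : Equivalent U U') :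
    IsSmallInter U' V := by
  obtain ⟨H, hH, h⟩ := h
  have h1 := hH.isFiniteOver_symmDiff hU
  obtain ⟨_, K, -, hK, -⟩ := hU
  refine ⟨K, hH.of_almostEqualOver hK h1, ?_⟩
  rw [← isFiniteOver_congr hH hK h1]
  refine (h.union h1).mono fun x hx => ?_
  simp only [Set.mem_union, Set.mem_inter_iff, Set.mem_symmDiff] at *
  tauto

/-- Smallness of an intersection depends only on the equivalence classes of the two sets. -/
theorem IsSmallInter.congr (h : IsSmallInter U V) (hV : IsNontrivial V) (hUU : Equivalent U U')
    (hVV : Equivalent V V') : IsSmallInter U' V' := by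
  have hU : IsNontrivial U := let ⟨H, hH, _⟩ := h; ⟨H, hH⟩
  exact (hU.of_equivalent hUU).isSmallInter_comm
    ((hV.isSmallInter_comm (h.congr_left hUU)).congr_left hVV)

theorem isSmallInter_congr (hU : IsNontrivial U) (hV : IsNontrivial V) (hUU : Equivalent U U')
    (hVV : Equivalent V V') : IsSmallInter U V ↔ IsSmallInter U' V' :=
  ⟨fun h => h.congr hV hUU hVV, fun h => h.congr (hV.of_equivalent hVV)
    (hU.equivalent_symm hUU) (hV.equivalent_symm hVV)⟩

theorem IsNontrivial.isSmallInter_of_inter_eq_empty (hU : IsNontrivial U) (h : U ∩ V = ∅) :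
    IsSmallInter U V :=
  let ⟨H, hH⟩ := hU
  ⟨H, hH, h ▸ isFiniteOver_empty H⟩

/-- The two corners of a nontrivial almost invariant set inside it are not both small. -/
theorem IsSmallInter.not_compl (h : IsSmallInter U V) : ¬ IsSmallInter U Vᶜ := by
  obtain ⟨H, hU, h⟩ := h
  rw [isSmallInter_iff hU]
  intro h'
  refine hU.not_isFiniteOver ((h.union h').mono fun x hx => ?_)
  simp only [Set.mem_union, Set.mem_inter_iff, Set.mem_compl_iff]
  tauto

theorem IsNontrivial.equivalent_iff (hU : IsNontrivial U) (hV : IsNontrivial V) :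
    Equivalent U V ↔ IsSmallInter U Vᶜ ∧ IsSmallInter Uᶜ V := by
  obtain ⟨H, hU⟩ := hU
  obtain ⟨K, hV⟩ := hV
  rw [isSmallInter_iff hU, isSmallInter_iff hU.compl]
  constructor
  · intro h
    have h1 := hU.isFiniteOver_symmDiff h
    constructor <;>
    · refine h1.mono fun x hx => ?_
      simp only [Set.mem_inter_iff, Set.mem_symmDiff, Set.mem_compl_iff] at *
      tauto
  · rintro ⟨h, h'⟩
    refine ⟨H, K, hU.1, hV.1, (h.union h').mono fun x hx => ?_⟩
    simp only [Set.mem_union, Set.mem_inter_iff, Set.mem_symmDiff, Set.mem_compl_iff] at *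
    tauto

end Equivalence

/-! ### Translates in good position -/

section Translates

variable {ι : Type*} {X : ι → Set G}

theorem mem_translates_iff {A : Set G} :
    A ∈ translates X ↔ ∃ (g : G) (i : ι) (ε : Bool), A = g • signed (X i) ε := by
  refine exists_congr fun g => exists_congr fun i => ?_
  simp only [Bool.exists_bool, signed]
  exact or_comm

theorem IsNontrivial.signed {U : Set G} (h : IsNontrivial U) (ε : Bool) :
    IsNontrivial (signed U ε) := by
  cases ε
  · exact h.compl
  · exact h

theorem Equivalent.signed {U V : Set G} (h : Equivalent U V) (ε : Bool) :
    Equivalent (signed U ε) (signed V ε) := by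
  cases ε
  · exact h.compl
  · exact h

theorem isNontrivial_of_mem_translates (hX : ∀ i, IsNontrivial (X i)) {A : Set G}
    (hA : A ∈ translates X) : IsNontrivial A := by
  obtain ⟨g, i, ε, rfl⟩ := mem_translates_iff.1 hA
  exact ((hX i).signed ε).smul g

/-- Equivalent translates in good position are comparable for inclusion. -/
theorem GoodPosition.subset_or_subset (h : GoodPosition X) (hX : ∀ i, IsNontrivial (X i))
    {A B : Set G} (hA : A ∈ translates X) (hB : B ∈ translates X) (hAB : Equivalent A B) :
    A ⊆ B ∨ B ⊆ A := by
  have nA := isNontrivial_of_mem_translates hX hA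
  have nB := isNontrivial_of_mem_translates hX hB
  obtain ⟨h1, h2⟩ := (nA.equivalent_iff nB).1 hAB
  obtain ⟨c, d, hcd⟩ := h A hA B hB true false false true (by simp) h1 h2
  -- An empty `A ∩ B` or `A* ∩ B*` would make `A` or `A*` a union of two small corners, so the empty
  -- corner is one of the other two.
  cases c <;> cases d <;> simp only [AlmostInvariant.signed] at hcd
  · exact absurd (nA.compl.isSmallInter_of_inter_eq_empty hcd) h2.not_compl
  · right
    rwa [Set.inter_comm, ← Set.sdiff_eq, Set.sdiff_eq_empty] at hcd
  · left
    rwa [← Set.sdiff_eq, Set.sdiff_eq_empty] at hcd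
  · exact absurd h1 (nA.isSmallInter_of_inter_eq_empty hcd).not_compl

/-- If `g⁻¹z` lies in `Hf`, then `gU = zf⁻¹U`, because `H` fixes `U`. So each of the finitely many
cosets contributes one translate. -/
theorem finite_translates_of_isFiniteOver {H : Subgroup G} {U W : Set G}
    (hU : IsAlmostInvariant H U) (hW : IsFiniteOver H W) (z : G) :
    {A : Set G | ∃ g : G, A = g • U ∧ g⁻¹ * z ∈ W}.Finite := by
  obtain ⟨F, hF, hW⟩ := hW
  refine (hF.image fun f => (z * f⁻¹) • U).subset ?_
  rintro _ ⟨g, rfl, hg⟩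
  obtain ⟨k, hk, f, hf, e⟩ := Set.mem_mul.1 (hW hg)
  refine ⟨f, hf, ?_⟩
  have : z * f⁻¹ = g * k := by
    rw [mul_inv_eq_iff_eq_mul, mul_assoc, e, mul_inv_cancel_left]
  simp only [this, mul_smul, hU.1 k hk]

/-- Only finitely many translates separate two given elements of `G`. -/
theorem finite_separating [Finite ι] (hX : ∀ i, IsNontrivial (X i)) (z w : G) :
    {A ∈ translates X | z ∈ A ∧ w ∉ A}.Finite := by
  choose H hH using fun i ε => (hX i).signed ε
  refine (Set.finite_iUnion fun p : ι × Bool => finite_translates_of_isFiniteOver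
    (hH p.1 p.2).1 ((hH p.1 p.2).1.isFiniteOver_boundary (z⁻¹ * w)) z).subset ?_
  rintro A ⟨hA, hz, hw⟩
  obtain ⟨g, i, ε, rfl⟩ := mem_translates_iff.1 hA
  refine Set.mem_iUnion.2 ⟨(i, ε), g, rfl, ?_⟩
  rw [Set.mem_smul_set_iff_inv_smul_mem, smul_eq_mul] at hz hw
  have : g⁻¹ * z * (z⁻¹ * w) = g⁻¹ * w := by group
  simp only [Set.mem_ofPred_eq, this]
  tauto

end Translates

/-! ### Contraction of equivalent sets -/

section Inclusion

variable {U V : Set G}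

theorem pow_mul_mem {g : G} (h : g • U ⊆ U) {x : G} (hx : x ∈ U) (n : ℕ) : g ^ n * x ∈ U := by
  induction n with
  | zero => simpa using hx
  | succ n ih =>
    rw [pow_succ', mul_assoc]
    exact h (Set.smul_mem_smul_set ih)

/-- The chain `V ⊆ gV ⊆ … ⊆ gᵖV = V` collapses. -/
theorem smul_subset_of_pow_smul_eq {g : G} {p : ℕ} (hp : 0 < p) (h : V ⊆ g • V)
    (hg : g ^ p • V = V) : g • V ⊆ V := by
  have key : ∀ n : ℕ, V ⊆ g ^ n • V := by
    intro n
    induction n with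
    | zero => simp
    | succ n ih =>
      rw [pow_succ', mul_smul]
      exact h.trans (Set.smul_set_mono ih)
  obtain ⟨q, rfl⟩ : ∃ q, p = q + 1 := ⟨p - 1, by omega⟩
  conv_rhs => rw [← hg, pow_succ', mul_smul]
  exact Set.smul_set_mono (key q)

/-- An element contracting `U` does not expand a set equivalent to `U`. -/
theorem Equivalent.smul_subset (h : Equivalent U V) (hU : IsNontrivial U) {g : G}
    (hg : g • U ⊆ U) (hV : g • V ⊆ V ∨ V ⊆ g • V) : g • V ⊆ V := by
  refine hV.elim id fun hV => ?_
  obtain ⟨K, hK⟩ := hU.of_equivalent h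
  have hf := hK.isFiniteOver_symmDiff (hU.equivalent_symm h)
  have hVc : g • Vᶜ ⊆ Vᶜ := by
    rwa [Set.smul_set_compl, Set.compl_subset_compl]
  have hV' : g⁻¹ • V ⊆ V := by
    rwa [← Set.subset_smul_set_iff]
  have hUc : g⁻¹ • Uᶜ ⊆ Uᶜ := by
    rw [Set.smul_set_compl, Set.compl_subset_compl, Set.subset_smul_set_iff, inv_inv]
    exact hg
  -- With `gU ⊆ U` and `V ⊆ gV`, the set `U \ V` is stable under positive powers of `g` and `V \ U`
  -- under negative ones. Recurrence modulo `K` then gives a power fixing `V`; if both differences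
  -- are empty, `U = V`.
  by_cases h1 : ∃ x, x ∈ U ∧ x ∉ V
  · obtain ⟨x, hxU, hxV⟩ := h1
    obtain ⟨p, hp, hpK⟩ := exists_pow_mem_of_isFiniteOver hf (g := g) (x := x)
      fun n => Or.inr ⟨pow_mul_mem hg hxU n, pow_mul_mem hVc hxV n⟩
    exact smul_subset_of_pow_smul_eq hp hV (hK.1.1 _ hpK)
  by_cases h2 : ∃ x, x ∈ V ∧ x ∉ U
  · obtain ⟨x, hxV, hxU⟩ := h2
    obtain ⟨p, hp, hpK⟩ := exists_pow_mem_of_isFiniteOver hf (g := g⁻¹) (x := x)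
      fun n => Or.inl ⟨pow_mul_mem hV' hxV n, pow_mul_mem hUc hxU n⟩
    rw [inv_pow, inv_mem_iff] at hpK
    exact smul_subset_of_pow_smul_eq hp hV (hK.1.1 _ hpK)
  push Not at h1 h2
  rwa [← Set.Subset.antisymm h1 h2]

theorem IsNontrivial.equivalent_of_between {A B C : Set G} (hA : IsNontrivial A)
    (hB : IsNontrivial B) (hAC : Equivalent A C) (h1 : A ⊆ B) (h2 : B ⊆ C) : Equivalent A B := by
  obtain ⟨H, hA⟩ := hA
  obtain ⟨K, hB⟩ := hB
  refine ⟨H, K, hA.1, hB.1, (hA.isFiniteOver_symmDiff hAC).mono ?_⟩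
  intro x hx
  have := @h1 x
  have := @h2 x
  simp only [Set.mem_symmDiff] at *
  tauto

end Inclusion

/-! ### Sets equivalent to the complement of one of their translates -/

section Reflection

variable {ι : Type*} {X : ι → Set G} {A B : Set G} {r : G}

theorem IsNontrivial.equivalent_smul_compl (hA : IsNontrivial A)
    (hr : Equivalent (r • A) Aᶜ) : Equivalent A (r • Aᶜ) := by
  have := (hA.smul r).compl.equivalent_symm hr.compl
  rwa [compl_compl, ← Set.smul_set_compl] at this

theorem GoodPosition.smul_subset (h : GoodPosition X) (hX : ∀ i, IsNontrivial (X i))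
    (hA : A ∈ translates X) (nB : IsNontrivial B) (hBA : Equivalent B A) {g : G}
    (hgA : Equivalent (g • A) A) (hg : g • B ⊆ B) : g • A ⊆ A :=
  hBA.smul_subset nB hg (h.subset_or_subset hX (smul_mem_translates X g hA) hA hgA)

/-- Suppose `g` commutes with `r` and contracts `A`. Then it contracts the equivalent set `rA*`,
hence also `A*`, so it fixes `A`. This applies to whichever of `r²` and `r⁻²` contracts `A`. -/
theorem GoodPosition.smul_smul_eq (h : GoodPosition X) (hX : ∀ i, IsNontrivial (X i))
    (hA : A ∈ translates X) (hr : Equivalent (r • A) Aᶜ) : r • r • A = A := by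
  have nA := isNontrivial_of_mem_translates hX hA
  have hB := smul_mem_translates X r (compl_mem_translates X hA)
  have e1 : Equivalent A (r • Aᶜ) := nA.equivalent_smul_compl hr
  have e2 : Equivalent ((r * r) • A) A := by
    rw [mul_smul]
    exact ((nA.smul r).smul r).equivalent_trans (hr.smul r) (nA.equivalent_symm e1)
  have e3 : Equivalent ((r * r)⁻¹ • A) A := by
    have := (nA.smul (r * r)).equivalent_symm e2
    simpa only [inv_smul_smul] using this.smul (r * r)⁻¹
  have conv : ∀ g : G, Commute g r → Equivalent (g • A) A → g • A ⊆ A → A ⊆ g • A := by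
    intro g hgr hgA hg
    have e4 : Equivalent (g • r • Aᶜ) (r • Aᶜ) := by
      rw [smul_smul, hgr.eq, mul_smul, Set.smul_set_compl]
      exact hgA.compl.smul r
    have := h.smul_subset hX hB nA e1 e4 hg
    rwa [smul_smul, hgr.eq, mul_smul, Set.smul_set_subset_smul_set_iff, Set.smul_set_compl,
      Set.compl_subset_compl] at this
  have hc : Commute (r * r) r := (Commute.refl r).mul_left (Commute.refl r)
  rw [← mul_smul]
  obtain h1 | h1 := h.subset_or_subset hX (smul_mem_translates X (r * r) hA) hA e2
  · exact h1.antisymm (conv _ hc e2 h1)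
  · have h2 : (r * r)⁻¹ • A ⊆ A := by rwa [← Set.subset_smul_set_iff]
    have := conv _ hc.inv_left e3 h2
    rw [Set.subset_smul_set_iff, inv_inv] at this
    exact this.antisymm h1

/-- `A` is the lower end of the innermost pair `A ⊆ rA*` of translates swapped by `r`. -/
def IsCentral (X : ι → Set G) (r : G) (A : Set G) : Prop :=
  A ⊆ r • Aᶜ ∧ ∀ B ∈ translates X, A ⊆ B → B ⊆ r • Aᶜ → B = A ∨ B = r • Aᶜ

theorem GoodPosition.exists_isCentral [Finite ι] (h : GoodPosition X)
    (hX : ∀ i, IsNontrivial (X i)) {C : Set G} (hC : C ∈ translates X)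
    (hr : Equivalent (r • C) Cᶜ) :
    ∃ A ∈ translates X, Equivalent A C ∧ IsCentral X r A := by
  have nC := isNontrivial_of_mem_translates hX hC
  have eC : Equivalent C (r • Cᶜ) := nC.equivalent_smul_compl hr
  have hrefl : ∀ A ∈ translates X, Equivalent A C → Equivalent (r • A) Aᶜ := by
    intro A hA hAC
    have nA := isNontrivial_of_mem_translates hX hA
    exact (nA.smul r).equivalent_trans (hAC.smul r)
      ((nC.smul r).equivalent_trans hr (nA.equivalent_symm hAC).compl)
  let I : Set G → Set (Set G) := fun A => {B ∈ translates X | A ⊆ B ∧ B ⊆ r • Aᶜ}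
  let T : Set (Set G) := {A ∈ translates X | Equivalent A C ∧ A ⊆ r • Aᶜ}
  have hI : ∀ A ∈ translates X, (I A).Finite := by
    intro A hA
    obtain ⟨H, hH⟩ := isNontrivial_of_mem_translates hX hA
    obtain ⟨z, hz⟩ := nonempty_of_not_isFiniteOver hH.not_isFiniteOver
    obtain ⟨w, hw⟩ := nonempty_of_not_isFiniteOver (hH.smul r).not_isFiniteOver
    refine (finite_separating hX z w).subset ?_
    rintro B ⟨hB, h1, h2⟩
    refine ⟨hB, h1 hz, fun hwB => ?_⟩
    have := h2 hwB
    rw [Set.smul_set_compl] at this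
    exact this hw
  have hT : T.Nonempty := by
    obtain h1 | h1 := h.subset_or_subset hX hC
      (smul_mem_translates X r (compl_mem_translates X hC)) eC
    · exact ⟨C, hC, nC.equivalent_refl, h1⟩
    · refine ⟨r • Cᶜ, smul_mem_translates X r (compl_mem_translates X hC),
        nC.equivalent_symm eC, ?_⟩
      rwa [← Set.smul_set_compl, compl_compl, h.smul_smul_eq hX hC hr]
  obtain ⟨A, ⟨hA, hAC, hAr⟩, hmin⟩ :=
    -- The interval from `A` to `rA*` is finite, since its members separate a point of `A` from a
    -- point of `rA`. A pair with fewest translates in between is innermost.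
    (InvImage.wf (fun A => (I A).ncard) wellFounded_lt).has_min T hT
  have nA := isNontrivial_of_mem_translates hX hA
  have rA := h.smul_smul_eq hX hA (hrefl A hA hAC)
  refine ⟨A, hA, hAC, hAr, fun B hB h1 h2 => ?_⟩
  by_contra! hne
  have nB := isNontrivial_of_mem_translates hX hB
  have hAB := nA.equivalent_of_between nB (nA.equivalent_smul_compl (hrefl A hA hAC)) h1 h2
  have hBC := nB.equivalent_trans (nA.equivalent_symm hAB) hAC
  have rB := h.smul_smul_eq hX hB (hrefl B hB hBC)
  have eB := nB.equivalent_smul_compl (hrefl B hB hBC)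
  have hB' := smul_mem_translates X r (compl_mem_translates X hB)
  have hlt : ∀ A' ∈ translates X, A ⊆ A' → A' ≠ A → r • A'ᶜ ⊆ r • Aᶜ →
      (I A').ncard < (I A).ncard := by
    intro A' _ h3 h4 h5
    refine Set.ncard_lt_ncard ⟨fun D hD => ⟨hD.1, h3.trans hD.2.1, hD.2.2.trans h5⟩, fun hc => ?_⟩
      (hI A hA)
    exact h4 ((hc ⟨hA, subset_rfl, hAr⟩).2.1.antisymm h3)
  have hAB' : A ⊆ r • Bᶜ := by
    rw [← rA, Set.smul_set_subset_smul_set_iff, Set.subset_compl_comm, ← Set.smul_set_compl]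
    exact h2
  -- A translate `B` strictly between would have its mirror `rB*` between as well. The two in the
  -- right order bound a smaller interval, which omits `A`.
  obtain h3 | h3 := h.subset_or_subset hX hB hB' eB
  · refine hmin B ⟨hB, hBC, h3⟩ (hlt B hB h1 hne.1 ?_)
    rwa [Set.smul_set_subset_smul_set_iff, Set.compl_subset_compl]
  · have e : r • (r • Bᶜ)ᶜ = B := by rw [← Set.smul_set_compl, compl_compl, rB]
    refine hmin (r • Bᶜ) ⟨hB', ?_, ?_⟩ (hlt _ hB' hAB' ?_ ?_)
    · exact (nB.of_equivalent eB).equivalent_trans (nB.equivalent_symm eB) hBC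
    · rwa [e]
    · intro hc
      rw [hc] at e
      exact hne.2 e.symm
    · rwa [e]

/-- Write `g = kr`, where `k` preserves the class of `A`; the claim becomes `A ⊆ k(rA*)` iff `A ⊆
kA`. No translate lies strictly inside the pair `A ⊆ rA*`, so `k` cannot move `rA*` down without
crossing `A`. -/
theorem GoodPosition.smul_subset_compl_iff (h : GoodPosition X) (hX : ∀ i, IsNontrivial (X i))
    (hA : A ∈ translates X) (hi : ¬ IsInvertible A) (hr : Equivalent (r • A) Aᶜ)
    (hc : IsCentral X r A) {g : G}
    (hg : Equivalent (g • A) Aᶜ) : g • A ⊆ Aᶜ ↔ (r * g⁻¹) • A ⊆ A := by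
  obtain ⟨k, rfl⟩ : ∃ k, g = k * r := ⟨g * r⁻¹, by simp⟩
  have nA := isNontrivial_of_mem_translates hX hA
  have hB := smul_mem_translates X r (compl_mem_translates X hA)
  have eB : Equivalent A (r • Aᶜ) := nA.equivalent_smul_compl hr
  have hk : Equivalent (k • A) A := by
    have h1 := (nA.smul r).equivalent_symm hr
    have h2 := (nA.compl.smul k).equivalent_trans (h1.smul k) (by rwa [smul_smul])
    simpa [Set.smul_set_compl] using h2.compl
  have hk' : Equivalent (k⁻¹ • A) A := by
    simpa using ((nA.smul k).equivalent_symm hk).smul k⁻¹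
  have hkB : ∀ l : G, Equivalent (l • A) A → Equivalent (l • r • Aᶜ) (r • Aᶜ) := by
    intro l hl
    exact (nA.of_equivalent eB).smul l |>.equivalent_trans
      ((nA.equivalent_symm eB).smul l) ((nA.smul l).equivalent_trans hl eB)
  have e1 : r * (k * r)⁻¹ = k⁻¹ := by group
  rw [e1, ← Set.subset_smul_set_iff, Set.subset_compl_comm, ← Set.smul_set_compl, mul_smul]
  constructor
  · intro h1
    obtain h2 | h2 := h.subset_or_subset hX (smul_mem_translates X k hA) hA hk
    · have h3 := h.smul_subset hX hB nA eB (hkB k hk) h2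
      -- If `k` moves the pair down, `k(rA*)` is squeezed between `A` and `rA*`. Equality with `A`
      -- would make `A` invertible, and equality with `rA*` makes `k` fix `A` too.
      obtain h4 | h4 := hc.2 _ (smul_mem_translates X k hB) h1 h3
      · refine absurd ⟨k * r, ?_⟩ hi
        rw [eq_compl_comm, ← Set.smul_set_compl, mul_smul, h4]
      · have h5 : k⁻¹ • r • Aᶜ ⊆ r • Aᶜ := by
          rw [← Set.subset_smul_set_iff, h4]
        have := h.smul_subset hX hA (nA.of_equivalent eB) (nA.equivalent_symm eB) hk' h5
        rwa [Set.subset_smul_set_iff]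
    · exact h2
  · intro h1
    exact h1.trans (Set.smul_set_mono hc.1)

end Reflection

/-! ### Matching two families -/

theorem IsInvertible.of_smul_signed {U : Set G} {g : G} {ε : Bool}
    (h : IsInvertible (g • signed U ε)) : IsInvertible U := by
  obtain ⟨k, hk⟩ := h
  refine ⟨g⁻¹ * k * g, ?_⟩
  rw [← Set.smul_set_compl, smul_smul, ← inv_smul_eq_iff, smul_smul, ← mul_assoc] at hk
  cases ε
  · simpa [signed, Set.smul_set_compl] using congrArg compl hk
  · simpa [signed] using hk

theorem translates_const_subset {ι : Type*} (X : ι → Set G) (i : ι) :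
    translates (fun _ : Unit => X i) ⊆ translates X := by
  rintro A ⟨g, _, h⟩
  exact ⟨g, i, h⟩

theorem GoodPosition.const {ι : Type*} {X : ι → Set G} (h : GoodPosition X) (i : ι) :
    GoodPosition (fun _ : Unit => X i) := fun U hU V hV =>
  h U (translates_const_subset X i hU) V (translates_const_subset X i hV)

/-- Equivalent sets in good position have translates, up to complementation, that are compared in
the same way to the complements of their own translates. -/
theorem exists_compatible_translates {U V : Set G} (hU : IsNontrivial U) (hUV : Equivalent U V)
    (gU : GoodPosition (fun _ : Unit => U)) (gV : GoodPosition (fun _ : Unit => V))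
    (iU : ¬ IsInvertible U) (iV : ¬ IsInvertible V) :
    ∃ A ∈ translates (fun _ : Unit => U), ∃ B ∈ translates (fun _ : Unit => V),
      Equivalent A U ∧ Equivalent B V ∧
        ∀ g : G, Equivalent (g • A) Aᶜ → (g • A ⊆ Aᶜ ↔ g • B ⊆ Bᶜ) := by
  have hV := hU.of_equivalent hUV
  have memU : U ∈ translates (fun _ : Unit => U) := ⟨1, (), by simp⟩
  have memV : V ∈ translates (fun _ : Unit => V) := ⟨1, (), by simp⟩
  by_cases hr : ∃ r : G, Equivalent (r • U) Uᶜ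
  · obtain ⟨r, hr⟩ := hr
    have hrV : Equivalent (r • V) Vᶜ := (hV.smul r).equivalent_trans
      ((hU.equivalent_symm hUV).smul r) ((hU.smul r).equivalent_trans hr hUV.compl)
    obtain ⟨A, hA, hAU, hcA⟩ := gU.exists_isCentral (fun _ => hU) memU hr
    obtain ⟨B, hB, hBV, hcB⟩ := gV.exists_isCentral (fun _ => hV) memV hrV
    have nA := isNontrivial_of_mem_translates (fun _ => hU) hA
    have nB := isNontrivial_of_mem_translates (fun _ => hV) hB
    have hAB : Equivalent A B :=
      nA.equivalent_trans hAU (hU.equivalent_trans hUV (nB.equivalent_symm hBV))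
    have hBA := nA.equivalent_symm hAB
    have iA : ¬ IsInvertible A := by
      obtain ⟨k, -, ε, rfl⟩ := mem_translates_iff.1 hA
      exact fun h => iU h.of_smul_signed
    have iB : ¬ IsInvertible B := by
      obtain ⟨k, -, ε, rfl⟩ := mem_translates_iff.1 hB
      exact fun h => iV h.of_smul_signed
    have hrA : Equivalent (r • A) Aᶜ := (nA.smul r).equivalent_trans (hAU.smul r)
      ((hU.smul r).equivalent_trans hr (nA.equivalent_symm hAU).compl)
    have toB : ∀ g : G, Equivalent (g • A) Aᶜ → Equivalent (g • B) Bᶜ := fun g hg =>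
      (nB.smul g).equivalent_trans (hBA.smul g) ((nA.smul g).equivalent_trans hg hAB.compl)
    refine ⟨A, hA, B, hB, hAU, hBV, fun g hg => ?_⟩
    -- The same `r` is central for both sets. What remains is whether `rg⁻¹`, which preserves the
    -- class, contracts `A` or `B`.
    rw [gU.smul_subset_compl_iff (fun _ => hU) hA iA hrA hcA hg,
      gV.smul_subset_compl_iff (fun _ => hV) hB iB (toB r hrA) hcB (toB g hg)]
    have hkA : Equivalent ((r * g⁻¹) • A) A := by
      have h1 := ((nA.smul g).equivalent_symm hg).smul (r * g⁻¹)
      rw [smul_smul, inv_mul_cancel_right, Set.smul_set_compl] at h1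
      have h2 := ((nA.smul _).compl.equivalent_trans h1 hrA).compl
      rwa [compl_compl, compl_compl] at h2
    have hkB : Equivalent ((r * g⁻¹) • B) B := (nB.smul _).equivalent_trans (hBA.smul _)
      ((nA.smul _).equivalent_trans hkA hAB)
    exact ⟨gV.smul_subset (fun _ => hV) hB nA hAB hkB, gU.smul_subset (fun _ => hU) hA nB hBA hkA⟩
  · exact ⟨U, memU, V, memV, hU.equivalent_refl, hV.equivalent_refl,
      fun g hg => absurd ⟨g, hg⟩ hr⟩

section Matching

variable {ι : Type*}

/-- Two families of pairwise equivalent sets, each in good position, whose translates by the same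
elements are compared in the same way. -/
structure Matched (Y Z : ι → Set G) : Prop where
  nontrivial_left : ∀ i, IsNontrivial (Y i)
  equivalent : ∀ i, Equivalent (Y i) (Z i)
  goodPosition_left : GoodPosition Y
  goodPosition_right : GoodPosition Z
  index_eq : ∀ (g k : G) (i j : ι) (ε δ : Bool),
    Equivalent (g • signed (Y i) ε) (k • signed (Y j) δ) → i = j
  not_isInvertible_left : ∀ i, ¬ IsInvertible (Y i)
  not_isInvertible_right : ∀ i, ¬ IsInvertible (Z i)
  subset_compl_iff : ∀ (i : ι) (g : G), Equivalent (g • Y i) (Y i)ᶜ →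
    (g • Y i ⊆ (Y i)ᶜ ↔ g • Z i ⊆ (Z i)ᶜ)

/-- `A` and `B` are corresponding translates of members of the families `Y` and `Z`. -/
def Corresponding (Y Z : ι → Set G) (A B : Set G) : Prop :=
  ∃ (g : G) (i : ι) (ε : Bool), A = g • signed (Y i) ε ∧ B = g • signed (Z i) ε

variable {Y Z : ι → Set G} {A B C D : Set G}

theorem Corresponding.symm (h : Corresponding Y Z A B) : Corresponding Z Y B A := by
  obtain ⟨g, i, ε, hA, hB⟩ := h
  exact ⟨g, i, ε, hB, hA⟩

theorem Corresponding.smul (h : Corresponding Y Z A B) (k : G) :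
    Corresponding Y Z (k • A) (k • B) := by
  obtain ⟨g, i, ε, rfl, rfl⟩ := h
  exact ⟨k * g, i, ε, by rw [mul_smul], by rw [mul_smul]⟩

theorem Corresponding.compl (h : Corresponding Y Z A B) : Corresponding Y Z Aᶜ Bᶜ := by
  obtain ⟨g, i, ε, rfl, rfl⟩ := h
  refine ⟨g, i, !ε, ?_, ?_⟩ <;> cases ε <;> simp [signed, Set.smul_set_compl]

theorem Corresponding.mem_left (h : Corresponding Y Z A B) : A ∈ translates Y := by
  obtain ⟨g, i, ε, rfl, rfl⟩ := h
  exact mem_translates_iff.2 ⟨g, i, ε, rfl⟩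

theorem exists_corresponding (hA : A ∈ translates Y) : ∃ B, Corresponding Y Z A B := by
  obtain ⟨g, i, ε, rfl⟩ := mem_translates_iff.1 hA
  exact ⟨_, g, i, ε, rfl, rfl⟩

namespace Matched

theorem nontrivial_right (h : Matched Y Z) (i : ι) : IsNontrivial (Z i) :=
  (h.nontrivial_left i).of_equivalent (h.equivalent i)

theorem equivalent_signed (h : Matched Y Z) (g : G) (i : ι) (ε : Bool) :
    Equivalent (g • signed (Y i) ε) (g • signed (Z i) ε) :=
  ((h.equivalent i).signed ε).smul g

theorem equivalent_of_corresponding (h : Matched Y Z) (hAB : Corresponding Y Z A B) :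
    Equivalent A B := by
  obtain ⟨g, i, ε, rfl, rfl⟩ := hAB
  exact h.equivalent_signed g i ε

theorem symm (h : Matched Y Z) : Matched Z Y where
  nontrivial_left := h.nontrivial_right
  equivalent i := (h.nontrivial_left i).equivalent_symm (h.equivalent i)
  goodPosition_left := h.goodPosition_right
  goodPosition_right := h.goodPosition_left
  index_eq g k i j ε δ hij := by
    have nY := fun g i ε => ((h.nontrivial_left i).signed ε).smul g
    have nZ := fun g i ε => ((h.nontrivial_right i).signed ε).smul g
    exact h.index_eq g k i j ε δ ((nY g i ε).equivalent_trans (h.equivalent_signed g i ε)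
      ((nZ g i ε).equivalent_trans hij ((nY k j δ).equivalent_symm (h.equivalent_signed k j δ))))
  not_isInvertible_left := h.not_isInvertible_right
  not_isInvertible_right := h.not_isInvertible_left
  subset_compl_iff i g hg := by
    have nY := h.nontrivial_left i
    have nZ := h.nontrivial_right i
    have e := h.equivalent i
    exact (h.subset_compl_iff i g ((nY.smul g).equivalent_trans (e.smul g)
      ((nZ.smul g).equivalent_trans hg (nY.equivalent_symm e).compl))).symm

theorem equivalent_right (h : Matched Y Z) (hAB : Corresponding Y Z A B)
    (hCD : Corresponding Y Z C D) (hAC : Equivalent A C) : Equivalent B D := by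
  have nA := isNontrivial_of_mem_translates h.nontrivial_left hAB.mem_left
  have nC := isNontrivial_of_mem_translates h.nontrivial_left hCD.mem_left
  have nB := nA.of_equivalent (h.equivalent_of_corresponding hAB)
  exact nB.equivalent_trans (nA.equivalent_symm (h.equivalent_of_corresponding hAB))
    (nA.equivalent_trans hAC (h.equivalent_of_corresponding hCD))

/-- `k⁻¹g` contracts `Y i`, hence contracts the equivalent set `Z i`. -/
theorem smul_subset_smul (h : Matched Y Z) {g k : G} {i : ι}
    (hgk : Equivalent (g • Y i) (k • Y i)) (hs : g • Y i ⊆ k • Y i) : g • Z i ⊆ k • Z i := by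
  have mZ : Z i ∈ translates Z := ⟨1, i, by simp⟩
  have e1 : Equivalent (g • Z i) (k • Z i) := h.equivalent_right (C := k • Y i)
    (A := g • Y i) ⟨g, i, true, rfl, rfl⟩ ⟨k, i, true, rfl, rfl⟩ hgk
  have e2 : Equivalent ((k⁻¹ * g) • Z i) (Z i) := by
    simpa only [inv_smul_smul, smul_smul, inv_mul_cancel, one_smul] using e1.smul k⁻¹
  rw [Set.subset_smul_set_iff, smul_smul] at hs ⊢
  exact h.goodPosition_right.smul_subset h.nontrivial_right mZ (h.nontrivial_left i)
    (h.equivalent i) e2 hs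

theorem smul_subset_smul_compl (h : Matched Y Z) {g k : G} {i : ι}
    (hgk : Equivalent (g • Y i) (k • (Y i)ᶜ)) (hs : g • Y i ⊆ k • (Y i)ᶜ) :
    g • Z i ⊆ k • (Z i)ᶜ := by
  have e2 : Equivalent ((k⁻¹ * g) • Y i) (Y i)ᶜ := by
    simpa only [inv_smul_smul, smul_smul, inv_mul_cancel, one_smul] using hgk.smul k⁻¹
  rw [Set.subset_smul_set_iff, smul_smul] at hs ⊢
  exact (h.subset_compl_iff i _ e2).1 hs

theorem subset_of_subset (h : Matched Y Z) (hAB : Corresponding Y Z A B)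
    (hCD : Corresponding Y Z C D) (hAC : Equivalent A C) (hs : A ⊆ C) : B ⊆ D := by
  have hBD := h.equivalent_right hAB hCD hAC
  have nA := isNontrivial_of_mem_translates h.nontrivial_left hAB.mem_left
  have nB := isNontrivial_of_mem_translates h.nontrivial_right hAB.symm.mem_left
  have hcomp := h.goodPosition_right.subset_or_subset h.nontrivial_right hAB.symm.mem_left
    hCD.symm.mem_left hBD
  obtain ⟨g, i, ε, rfl, rfl⟩ := hAB
  obtain ⟨k, j, δ, rfl, rfl⟩ := hCD
  obtain rfl := h.index_eq g k i j ε δ hAC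
  cases ε <;> cases δ <;> simp only [signed] at *
  · rw [Set.smul_set_compl, Set.smul_set_compl, Set.compl_subset_compl] at hs ⊢
    refine h.smul_subset_smul ?_ hs
    simpa [Set.smul_set_compl] using (nA.equivalent_symm hAC).compl
  -- The compatibility field covers only translates below complements, so the reverse inclusion for
  -- `Z` is transferred back to `Y`. There it gives equality, contradicting noninvertibility.
  · refine hcomp.elim id fun hcomp => ?_
    have h1 := h.symm.smul_subset_smul_compl (nB.equivalent_symm hBD) hcomp
    refine absurd ⟨g⁻¹ * k, ?_⟩ (h.not_isInvertible_left i)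
    rw [mul_smul, ← hs.antisymm h1, inv_smul_smul]
  · exact h.smul_subset_smul_compl hAC hs
  · exact h.smul_subset_smul hAC hs

/-- Makes the correspondence a map: different expressions of one translate of `Y` give translates of
`Z` included in each other. -/
theorem right_unique (h : Matched Y Z) (hAB : Corresponding Y Z A B)
    (hAD : Corresponding Y Z A D) : B = D :=
  have e := (isNontrivial_of_mem_translates h.nontrivial_left hAB.mem_left).equivalent_refl
  (h.subset_of_subset hAB hAD e subset_rfl).antisymm (h.subset_of_subset hAD hAB e subset_rfl)

/-- The clause about small corners transfers by equivalence. An empty corner transfers by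
`subset_of_subset` when `A` and `C` are equivalent, and otherwise is the only small corner. -/
theorem almostLE_of_almostLE (h : Matched Y Z) (hAB : Corresponding Y Z A B)
    (hCD : Corresponding Y Z C D) (hs : AlmostLE A C) : AlmostLE B D := by
  have nA := isNontrivial_of_mem_translates h.nontrivial_left hAB.mem_left
  have nC := isNontrivial_of_mem_translates h.nontrivial_left hCD.mem_left
  have eA := h.equivalent_of_corresponding hAB
  have eC := h.equivalent_of_corresponding hCD
  unfold AlmostLE at *
  rw [← isSmallInter_congr nA nC eA eC, ← isSmallInter_congr nA nC.compl eA eC.compl,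
    ← isSmallInter_congr nA.compl nC eA.compl eC,
    ← isSmallInter_congr nA.compl nC.compl eA.compl eC.compl]
  obtain hs | hs := hs
  · by_cases hAC : Equivalent A C
    · left
      rw [← Set.sdiff_eq, Set.sdiff_eq_empty] at hs ⊢
      exact h.subset_of_subset hAB hCD hAC hs
    · have hsm := nA.isSmallInter_of_inter_eq_empty hs
      refine Or.inr ⟨hsm, fun hc => hc.not_compl hsm,
        fun hc => hAC ((nA.equivalent_iff nC).2 ⟨hsm, hc⟩), fun hc => ?_⟩
      exact (nC.compl.isSmallInter_comm hsm).not_compl (nC.compl.isSmallInter_comm hc)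
  · exact Or.inr hs

theorem almostLE_iff (h : Matched Y Z) (hAB : Corresponding Y Z A B)
    (hCD : Corresponding Y Z C D) : AlmostLE A C ↔ AlmostLE B D :=
  ⟨h.almostLE_of_almostLE hAB hCD, h.symm.almostLE_of_almostLE hAB.symm hCD.symm⟩

/-- Only finitely many pairs of corresponding translates are distinguished by a given element. -/
theorem finite_not_mem_iff [Finite ι] (h : Matched Y Z) (z : G) :
    {A : Set G | ∃ B, Corresponding Y Z A B ∧ ¬ (z ∈ A ↔ z ∈ B)}.Finite := by
  choose H hH using fun i ε => (h.nontrivial_left i).signed ε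
  refine (Set.finite_iUnion fun p : ι × Bool => finite_translates_of_isFiniteOver
    (hH p.1 p.2).1 ((hH p.1 p.2).isFiniteOver_symmDiff ((h.equivalent p.1).signed p.2)) z).subset ?_
  rintro A ⟨B, ⟨g, i, ε, rfl, rfl⟩, hz⟩
  refine Set.mem_iUnion.2 ⟨(i, ε), g, rfl, ?_⟩
  rw [Set.mem_smul_set_iff_inv_smul_mem, Set.mem_smul_set_iff_inv_smul_mem, smul_eq_mul] at hz
  simp only [Set.mem_symmDiff]
  tauto

end Matched

end Matching

/-! ### Isomorphisms of cubings -/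

section Cubings

variable {ι κ : Type*} {Y : ι → Set G} {Z : κ → Set G}

/-- An isomorphism from `E(Y)` to `E(Z)`, compatible with the action of `G`, with complementation
and with almost inclusion, under which every element of `G` lies in the same elements up to finitely
many exceptions. -/
structure TranslatesIso (Y : ι → Set G) (Z : κ → Set G) where
  /-- the underlying bijection -/
  toEquiv : translates Y ≃ translates Z
  map_smul : ∀ (g : G) (A : translates Y), toEquiv (g • A) = g • toEquiv A
  map_star : ∀ A : translates Y, toEquiv (star A) = star (toEquiv A)
  almostLE_iff : ∀ A B : translates Y, AlmostLE A.1 B.1 ↔ AlmostLE (toEquiv A).1 (toEquiv B).1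
  finite_not_mem_iff : ∀ g : G, {A : translates Y | ¬ (g ∈ A.1 ↔ g ∈ (toEquiv A).1)}.Finite

namespace TranslatesIso

/-- The inverse isomorphism. -/
def symm (φ : TranslatesIso Y Z) : TranslatesIso Z Y where
  toEquiv := φ.toEquiv.symm
  map_smul g A := by rw [Equiv.symm_apply_eq, φ.map_smul, Equiv.apply_symm_apply]
  map_star A := by rw [Equiv.symm_apply_eq, φ.map_star, Equiv.apply_symm_apply]
  almostLE_iff A B := by
    rw [φ.almostLE_iff, Equiv.apply_symm_apply, Equiv.apply_symm_apply]
  finite_not_mem_iff g := by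
    refine ((φ.finite_not_mem_iff g).image φ.toEquiv).subset fun A hA => ?_
    refine ⟨φ.toEquiv.symm A, ?_, φ.toEquiv.apply_symm_apply A⟩
    simp only [Set.mem_ofPred_eq, Equiv.apply_symm_apply] at hA ⊢
    tauto

/-- The image of an ultrafilter. -/
def mapUltrafilter (φ : TranslatesIso Y Z) (V : UltrafilterOn Y) : UltrafilterOn Z where
  carrier := φ.toEquiv '' V.carrier
  mem_or A := by
    have := φ.symm.map_star A
    simp only [symm] at this
    simp only [Set.mem_image_equiv, this]
    exact V.mem_or _
  not_both A := by
    have := φ.symm.map_star A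
    simp only [symm] at this
    simp only [Set.mem_image_equiv, this]
    exact V.not_both _
  upward A hA B hAB := by
    rw [Set.mem_image_equiv] at hA ⊢
    exact V.upward _ hA _ ((φ.symm.almostLE_iff A B).1 hAB)

theorem symm_mapUltrafilter (φ : TranslatesIso Y Z) (V : UltrafilterOn Y) :
    φ.symm.mapUltrafilter (φ.mapUltrafilter V) = V :=
  UltrafilterOn.ext (φ.toEquiv.symm_image_image V.carrier)

theorem mapUltrafilter_smul (φ : TranslatesIso Y Z) (g : G) (V : UltrafilterOn Y) :
    φ.mapUltrafilter (g • V) = g • φ.mapUltrafilter V := by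
  refine UltrafilterOn.ext ?_
  rw [carrier_smul]
  change φ.toEquiv '' (g • V.carrier) = g • (φ.toEquiv '' V.carrier)
  rw [← Set.image_smul, ← Set.image_smul, Set.image_image, Set.image_image]
  simp only [φ.map_smul]

theorem adj_mapUltrafilter (φ : TranslatesIso Y Z) {V W : UltrafilterOn Y}
    (h : (skeleton Y).Adj V W) :
    (skeleton Z).Adj (φ.mapUltrafilter V) (φ.mapUltrafilter W) := by
  obtain ⟨A, hA, hW⟩ := h
  refine ⟨φ.toEquiv A, ⟨A, hA, rfl⟩, ?_⟩
  change φ.toEquiv '' W.carrier = φ.toEquiv '' V.carrier \ _ ∪ _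
  rw [hW, Set.image_union, Set.image_sdiff φ.toEquiv.injective, Set.image_singleton,
    Set.image_singleton, φ.map_star]

/-- The same `g` works: the new discrepancies come from old ones or from the finitely many
translates that `g` distinguishes from their images. -/
theorem isBasic_mapUltrafilter (φ : TranslatesIso Y Z) {W : UltrafilterOn Y} (h : IsBasic W) :
    IsBasic (φ.mapUltrafilter W) := by
  obtain ⟨g, hg⟩ := h
  refine ⟨g, ((hg.image φ.toEquiv).union ((φ.finite_not_mem_iff g).image φ.toEquiv)).subset ?_⟩
  intro B hB
  obtain ⟨A, rfl⟩ := φ.toEquiv.surjective B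
  have h1 : φ.toEquiv A ∈ (φ.mapUltrafilter W).carrier ↔ A ∈ W.carrier :=
    φ.toEquiv.injective.mem_set_image
  simp only [Set.mem_union, φ.toEquiv.injective.mem_set_image, Set.mem_symmDiff,
    Set.mem_ofPred_eq, h1] at hB ⊢
  tauto

/-- The image of a vertex of the cubing `L(Y)`. -/
def mapVertex (φ : TranslatesIso Y Z) (V : LVertex Y) : LVertex Z :=
  ⟨φ.mapUltrafilter V.1, by
    obtain ⟨W, hW, hr⟩ := V.2
    let f : skeleton Y →g skeleton Z := ⟨φ.mapUltrafilter, fun h => φ.adj_mapUltrafilter h⟩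
    exact ⟨φ.mapUltrafilter W, φ.isBasic_mapUltrafilter hW, hr.map f⟩⟩

/-- The bijection between the vertices of the cubings `L(Y)` and `L(Z)`. -/
def vertexEquiv (φ : TranslatesIso Y Z) : LVertex Y ≃ LVertex Z where
  toFun := φ.mapVertex
  invFun := φ.symm.mapVertex
  left_inv V := Subtype.ext (φ.symm_mapUltrafilter V.1)
  right_inv V := Subtype.ext (φ.symm.symm_mapUltrafilter V.1)

theorem isCube_image (φ : TranslatesIso Y Z) {d : ℕ} {S : Set (LVertex Y)} (h : IsCube Y d S) :
    IsCube Z d (φ.vertexEquiv '' S) := by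
  obtain ⟨f, hf, rfl, hadj⟩ := h
  exact ⟨φ.vertexEquiv ∘ f, φ.vertexEquiv.injective.comp hf, Set.range_comp _ _,
    fun a b hab => φ.adj_mapUltrafilter (hadj a b hab)⟩

theorem isCube_iff (φ : TranslatesIso Y Z) (d : ℕ) (S : Set (LVertex Y)) :
    IsCube Y d S ↔ IsCube Z d (φ.vertexEquiv '' S) := by
  refine ⟨φ.isCube_image, fun h => ?_⟩
  have := φ.symm.isCube_image h
  rwa [show φ.symm.vertexEquiv = φ.vertexEquiv.symm from rfl, Equiv.symm_image_image] at this

end TranslatesIso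

end Cubings

/-- The correspondence between the translates of two matched families, as an isomorphism. -/
theorem Matched.exists_translatesIso {ι κ : Type*} [Finite κ] {Y Z : ι → Set G}
    {Y' Z' : κ → Set G} (h : Matched Y' Z') (hY : translates Y' = translates Y)
    (hZ : translates Z' = translates Z) :
    ∃ φ : TranslatesIso Y Z, ∀ A, Corresponding Y' Z' A.1 (φ.toEquiv A).1 := by
  have hf : ∀ A : translates Y, ∃ B : translates Z, Corresponding Y' Z' A.1 B.1 := by
    rintro ⟨A, hA⟩
    obtain ⟨B, hB⟩ := exists_corresponding (Z := Z') (hY.symm ▸ hA)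
    exact ⟨⟨B, hZ ▸ hB.symm.mem_left⟩, hB⟩
  have hg : ∀ B : translates Z, ∃ A : translates Y, Corresponding Y' Z' A.1 B.1 := by
    rintro ⟨B, hB⟩
    obtain ⟨A, hA⟩ := exists_corresponding (Z := Y') (hZ.symm ▸ hB)
    exact ⟨⟨A, hY ▸ hA.symm.mem_left⟩, hA.symm⟩
  choose f hf using hf
  choose g hg using hg
  have f_eq : ∀ (A : translates Y) (B : translates Z), Corresponding Y' Z' A.1 B.1 → f A = B :=
    fun A B hAB => Subtype.ext (h.right_unique (hf A) hAB)
  refine ⟨{ toEquiv := ⟨f, g, fun A => ?_, fun B => f_eq _ _ (hg B)⟩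
            map_smul := fun k A => f_eq _ _ ((hf A).smul k)
            map_star := fun A => f_eq _ _ (hf A).compl
            almostLE_iff := fun A B => h.almostLE_iff (hf A) (hf B)
            finite_not_mem_iff := fun z => ?_ }, hf⟩
  · exact Subtype.ext (h.symm.right_unique (hg (f A)).symm (hf A).symm)
  · refine ((h.finite_not_mem_iff z).preimage Subtype.val_injective.injOn).subset ?_
    exact fun A hA => ⟨_, hf A, hA⟩

/-- Allows rebasing: central representatives generate the same set of translates, so good position
and the cubing are unaffected. -/
theorem translates_eq_of_mem {ι : Type*} {Y Y' : ι → Set G}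
    (h : ∀ i, Y' i ∈ translates (fun _ : Unit => Y i)) : translates Y' = translates Y := by
  refine Set.Subset.antisymm ?_ ?_
  · rintro A ⟨g, i, rfl | rfl⟩
    · exact smul_mem_translates Y g (translates_const_subset Y i (h i))
    · exact smul_mem_translates Y g (compl_mem_translates Y (translates_const_subset Y i (h i)))
  · have key : ∀ i, Y i ∈ translates Y' := by
      intro i
      obtain ⟨k, _, hk | hk⟩ := h i
      · exact ⟨k⁻¹, i, Or.inl (by rw [hk, inv_smul_smul])⟩
      · exact ⟨k⁻¹, i, Or.inr (by rw [hk, ← Set.smul_set_compl, compl_compl, inv_smul_smul])⟩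
    rintro A ⟨g, i, rfl | rfl⟩
    · exact smul_mem_translates Y' g (key i)
    · exact smul_mem_translates Y' g (compl_mem_translates Y' (key i))

theorem GoodPosition.of_translates_eq {ι κ : Type*} {Y : ι → Set G} {Y' : κ → Set G}
    (h : GoodPosition Y) (hY : translates Y' = translates Y) : GoodPosition Y' :=
  fun U hU V hV => h U (hY ▸ hU) V (hY ▸ hV)

/-- Signed translates of sets with nonparallel orbits are not equivalent. -/
theorem orbitsParallel_of_equivalent {U V U' V' : Set G} (hU : IsNontrivial U)
    (hV : IsNontrivial V) (hUU : Equivalent U U') (hVV : Equivalent V V') {g k : G} {ε δ : Bool}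
    (h : Equivalent (g • signed U' ε) (k • signed V' δ)) : OrbitsParallel U V := by
  have nU := (hU.signed ε).smul g
  have nU' := ((hU.of_equivalent hUU).signed ε).smul g
  have nV := (hV.signed δ).smul k
  have h1 : Equivalent (g • signed U ε) (k • signed V δ) := nU.equivalent_trans
    ((hUU.signed ε).smul g) (nU'.equivalent_trans h
      (nV.equivalent_symm ((hVV.signed δ).smul k)))
  have h2 := h1.smul k⁻¹
  rw [inv_smul_smul, smul_smul] at h2
  refine ⟨k⁻¹ * g, ?_⟩
  cases ε <;> cases δ <;> simp only [signed, Set.smul_set_compl] at h2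
  · left
    simpa using h2.compl
  · right
    simpa using h2.compl
  · exact Or.inr h2
  · exact Or.inl h2

end AlmostInvariant

open AlmostInvariant in
theorem mainTheorem5 {G : Type*} [Group G] [Group.FG G] (n : ℕ)
    (H : Fin n → Subgroup G) (hH : ∀ i, (H i).FG)
    (X Y Z : Fin n → Set G)
    (hX : ∀ i, IsNontrivialAlmostInvariant (H i) (X i))
    (hpar : ∀ i j, i ≠ j → ¬ OrbitsParallel (X i) (X j))
    (hXY : ∀ i, Equivalent (X i) (Y i)) (hXZ : ∀ i, Equivalent (X i) (Z i))
    (hY : GoodPosition Y) (hZ : GoodPosition Z)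
    (hYinv : ∀ i, ¬ IsInvertible (Y i)) (hZinv : ∀ i, ¬ IsInvertible (Z i)) :
    ∃ φ : translates Y ≃ translates Z,
      (∀ (g : G) (A : translates Y), φ (g • A) = g • φ A) ∧
      (∀ A : translates Y, φ (star A) = star (φ A)) ∧
      (∀ A B : translates Y, AlmostLE A.1 B.1 ↔ AlmostLE (φ A).1 (φ B).1) ∧
      (∀ A : translates Y, Equivalent A.1 (φ A).1) ∧
      ∃ ψ : LVertex Y ≃ LVertex Z,
        (∀ V : LVertex Y, (ψ V).1.carrier = φ '' V.1.carrier) ∧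
        (∀ (g : G) (V : LVertex Y), ψ (g • V) = g • ψ V) ∧
        ∀ (d : ℕ) (S : Set (LVertex Y)), IsCube Y d S ↔ IsCube Z d (ψ '' S) := by
  have nX : ∀ i, IsNontrivial (X i) := fun i => ⟨H i, hX i⟩
  have nY : ∀ i, IsNontrivial (Y i) := fun i => (nX i).of_equivalent (hXY i)
  have nZ : ∀ i, IsNontrivial (Z i) := fun i => (nX i).of_equivalent (hXZ i)
  have hYZ : ∀ i, Equivalent (Y i) (Z i) := fun i =>
    (nY i).equivalent_trans ((nX i).equivalent_symm (hXY i)) (hXZ i)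
  -- Each index is rebased separately, using the one-member families.
  choose Y' mY Z' mZ eY eZ hYZ' using fun i => exists_compatible_translates (nY i) (hYZ i)
    (hY.const i) (hZ.const i) (hYinv i) (hZinv i)
  have nY' : ∀ i, IsNontrivial (Y' i) := fun i =>
    isNontrivial_of_mem_translates (fun _ => nY i) (mY i)
  have nZ' : ∀ i, IsNontrivial (Z' i) := fun i =>
    isNontrivial_of_mem_translates (fun _ => nZ i) (mZ i)
  have tY := translates_eq_of_mem mY
  have tZ := translates_eq_of_mem mZ
  have eXY' : ∀ i, Equivalent (X i) (Y' i) := fun i =>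
    (nX i).equivalent_trans (hXY i) ((nY' i).equivalent_symm (eY i))
  have hm : Matched Y' Z' :=
    { nontrivial_left := nY'
      equivalent := fun i => (nY' i).equivalent_trans (eY i)
        ((nY i).equivalent_trans (hYZ i) ((nZ' i).equivalent_symm (eZ i)))
      goodPosition_left := hY.of_translates_eq tY
      goodPosition_right := hZ.of_translates_eq tZ
      index_eq := fun g k i j ε δ h => by
        by_contra hij
        exact hpar i j hij (orbitsParallel_of_equivalent (nX i) (nX j) (eXY' i) (eXY' j) h)
      not_isInvertible_left := fun i hi => by
        obtain ⟨g, -, ε, e⟩ := mem_translates_iff.1 (mY i)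
        exact hYinv i (e ▸ hi).of_smul_signed
      not_isInvertible_right := fun i hi => by
        obtain ⟨g, -, ε, e⟩ := mem_translates_iff.1 (mZ i)
        exact hZinv i (e ▸ hi).of_smul_signed
      subset_compl_iff := hYZ' }
  obtain ⟨φ, hφ⟩ := hm.exists_translatesIso tY tZ
  exact ⟨φ.toEquiv, φ.map_smul, φ.map_star, φ.almostLE_iff,
    fun A => hm.equivalent_of_corresponding (hφ A), φ.vertexEquiv, fun V => rfl,
    fun g V => Subtype.ext (φ.mapUltrafilter_smul g V.1), φ.isCube_iff⟩
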